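/- A straight-line program (SLP) over an alphabet $\Sigma$ is a context-free grammar with a finite set of nonterminals, a start nonterminal $S$, exactly one production $A\to w_A$ with $w_A$ nonempty for each nonterminal $A$, and an acyclic relation "$B$ occurs in $w_A$"; it produces a single nonempty word. Its size is $\sum_A |w_A|$, and $g(w)$ denotes the size of a smallest SLP producing the nonempty word $w$. The LZ78 factorization of $w\in\Sigma^+$ is $w=f_1\cdots f_\ell$, where, with $f_0=\varepsilon$, $f_i$ is successively the shortest prefix of the unprocessed suffix of $w$ that differs from $f_0,\dots,f_{i-1}$ and, once there is no such prefix, $f_\ell$ is the (possibly empty) unprocessed suffix; each $f_i$ with $i<\ell$ has the form $f_ja$ with $j<i$, $a\in\Sigma$, and $f_\ell=f_j$ for some $j<\ell$. The compressor LZ78 maps $w$ to the SLP $\mathsf{LZ78}(w)$ with nonterminals $S,F_1,\dots,F_{\ell-1}$ and productions $S\to F_1\cdots F_{\ell-1}F_j$ where $f_\ell=f_j$ ($F_j$ is omitted if $f_\ell=\varepsilon$), and $F_i\to F_ja$ where $f_i=f_ja$ ($F_i\to a$ if $f_j=\varepsilon$). For $k,n\ge 1$ let \[\alpha_{\mathsf{LZ78}}(k,n)=\max\Big\{\frac{|\mathsf{LZ78}(w)|}{g(w)}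 \;\Big|\; w\in\{1,\dots,k\}^n\Big\}.\] Theorem. For $2\le k\le n$ (where $k$ may depend on $n$) we have $\alpha_{\mathsf{LZ78}}(k,n)\in\Theta\big((n/\log n)^{2/3}\big)$, with constants independent of $k$ and $n$: there are constants $c,C>0$ such that for all integers $k,n$ with $2\le k\le n$, \[c\,(n/\log n)^{2/3}\;\le\;\alpha_{\mathsf{LZ78}}(k,n)\;\le\;C\,(n/\log n)^{2/3}.\] -/

import Mathlib

/-- A straight-line program over the terminal alphabet `σ`: finitely many nonterminals, a start
nonterminal, exactly one production `A → rhs A` with nonempty right-hand side for every nonterminal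
`A`, and an acyclic occurrence relation between nonterminals. -/
structure SLP (σ : Type) where
  /-- the nonterminals -/
  N : Type
  [fintypeN : Fintype N]
  /-- the start nonterminal -/
  start : N
  /-- the right-hand side of the unique production of a nonterminal -/
  rhs : N → List (Symbol σ N)
  rhs_ne_nil : ∀ A, rhs A ≠ []
  acyclic : ∀ A, ¬ Relation.TransGen (fun A B => Symbol.nonterminal B ∈ rhs A) A A

namespace SLP

variable {σ : Type} (G : SLP σ)

/-- The nonterminals form a finite type. -/
instance : Fintype G.N := G.fintypeN

/-- `G.Occurs B A`: the nonterminal `B` occurs on the right-hand side of the production of `A`. -/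
def Occurs (B A : G.N) : Prop := Symbol.nonterminal B ∈ G.rhs A

theorem wellFounded_occurs : WellFounded G.Occurs := by
  have : Std.Irrefl (Relation.TransGen G.Occurs) :=
    ⟨fun A h => G.acyclic A (Relation.transGen_swap.mp h)⟩
  have h : WellFounded (Relation.TransGen G.Occurs) :=
    Finite.wellFounded_of_trans_of_irrefl _
  exact Subrelation.wf (fun h => Relation.TransGen.single h) h

/-- The word produced by a nonterminal `A`: in the right-hand side of `A`, replace every
nonterminal by the word that it produces. -/
noncomputable def valOf : G.N → List σ :=
  G.wellFounded_occurs.fix fun A ih =>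
    (G.rhs A).attach.flatMap fun X =>
      match X with
      | ⟨Symbol.terminal a, _⟩ => [a]
      | ⟨Symbol.nonterminal B, h⟩ => ih B h

/-- The word that a single symbol stands for, when the nonterminals stand for the words `V`. -/
def symbolVal {N : Type} (V : N → List σ) : Symbol σ N → List σ
  | Symbol.terminal a => [a]
  | Symbol.nonterminal B => V B

/-- The defining equation of `valOf`. -/
theorem valOf_eq (A : G.N) : G.valOf A = (G.rhs A).flatMap (symbolVal G.valOf) := by
  rw [valOf, WellFounded.fix_eq]
  conv_rhs => rw [← List.attach_map_subtype_val (G.rhs A), List.flatMap_map]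
  congr 1
  funext X
  rcases X with ⟨_ | _, _⟩ <;> rfl

/-- The word defined by the SLP. -/
noncomputable def val : List σ := G.valOf G.start

/-- The size of an SLP: the total length of all right-hand sides. -/
def size : ℕ := ∑ A : G.N, (G.rhs A).length

end SLP

/-- `g(w)`: the size of a smallest SLP producing the (nonempty) word `w`. -/
noncomputable def smallestSLPSize {σ : Type} (w : List σ) : ℕ :=
  sInf {s | ∃ G : SLP σ, G.val = w ∧ G.size = s}

/-- A grammar-based compressor maps every nonempty word `w` to an SLP that produces `w`. -/
structure GrammarCompressor (σ : Type) where
  compress : (w : List σ) → w ≠ [] → SLP σ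
  val_compress : ∀ w hw, (compress w hw).val = w

namespace GrammarCompressor

variable {σ : Type}

/-- The approximation ratio of a compressor on a nonempty word. -/
noncomputable def ratio (C : GrammarCompressor σ) (w : List σ) (hw : w ≠ []) : ℝ :=
  ((C.compress w hw).size : ℝ) / (smallestSLPSize w : ℝ)

/-- The worst-case (maximal) approximation ratio of a compressor over all words of length `n`. -/
noncomputable def worstCaseRatio (C : GrammarCompressor σ) (n : ℕ) : ℝ :=
  sSup {r | ∃ (w : List σ) (hw : w ≠ []), w.length = n ∧ C.ratio w hw = r}

/-- Over a finite nonempty alphabet and for positive length, the supremum is a maximum. -/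
theorem isGreatest_worstCaseRatio [Finite σ] [Nonempty σ] (C : GrammarCompressor σ) {n : ℕ}
    (hn : n ≠ 0) :
    IsGreatest {r | ∃ (w : List σ) (hw : w ≠ []), w.length = n ∧ C.ratio w hw = r}
      (C.worstCaseRatio n) := by
  have hfin : {r | ∃ (w : List σ) (hw : w ≠ []), w.length = n ∧ C.ratio w hw = r}.Finite := by
    classical
    refine ((List.finite_length_eq σ n).image
      (fun w => if hw : w ≠ [] then C.ratio w hw else 0)).subset ?_
    rintro r ⟨w, hw, hl, rfl⟩
    exact ⟨w, hl, dif_pos hw⟩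
  have hne : {r | ∃ (w : List σ) (hw : w ≠ []), w.length = n ∧ C.ratio w hw = r}.Nonempty := by
    obtain ⟨a⟩ := ‹Nonempty σ›
    exact ⟨_, List.replicate n a, by simpa using hn, by simp, rfl⟩
  exact ⟨hne.csSup_mem hfin, fun r hr => le_csSup hfin.bddAbove hr⟩

end GrammarCompressor

section LZ78

variable {σ : Type}

/-- The words `D = f₁, …, f_{ℓ-1}` together with the last word `p = f_ℓ` have the properties of an
LZ78 factorization of `w` (with `f₀ = ε`): they concatenate to `w`; `f₀, …, f_{ℓ-1}` are pairwise
distinct; each of `f₁, …, f_{ℓ-1}` extends an earlier word (possibly `f₀`) by one letter; and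
`f_ℓ` is one of `f₀, …, f_{ℓ-1}`. -/
structure IsLZ78Factorization (w : List σ) (D : List (List σ)) (p : List σ) : Prop where
  flatten_eq : D.flatten ++ p = w
  nodup : ([] :: D).Nodup
  extends_earlier : ∀ (i : ℕ) (h : i < D.length),
    ∃ f ∈ [] :: D.take i, ∃ a : σ, D[i] = f ++ [a]
  last_mem : p ∈ [] :: D

theorem IsLZ78Factorization.getElem_ne_nil {w : List σ} {D : List (List σ)} {p : List σ}
    (hD : IsLZ78Factorization w D p) (i : Fin D.length) : D[i] ≠ [] := by
  intro h
  have := hD.nodup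
  rw [List.nodup_cons] at this
  exact this.1 (h ▸ List.getElem_mem i.2)

variable [DecidableEq σ]

/-- One letter of the left-to-right pass of LZ78. The state consists of the list of completed
factors and the part of the current factor that has been read. The current factor is extended by
the letter `a`; it is completed as soon as it differs from all previous factors. -/
def lz78Step (s : List (List σ) × List σ) (a : σ) : List (List σ) × List σ :=
  if s.2 ++ [a] ∈ s.1 then (s.1, s.2 ++ [a]) else (s.1 ++ [s.2 ++ [a]], [])

/-- The LZ78 factorization of `w`, computed in a single left-to-right pass: the first component is
the list `f₁, …, f_{ℓ-1}`, where each factor is the shortest nonempty prefix of the unprocessed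
suffix that differs from all previous factors, and the second component is the last factor `f_ℓ`,
which is the (possibly empty) unprocessed rest when no such prefix is left. -/
def lz78Factorization (w : List σ) : List (List σ) × List σ :=
  w.foldl lz78Step ([], [])

theorem isLZ78Factorization_lz78Factorization (w : List σ) :
    IsLZ78Factorization w (lz78Factorization w).1 (lz78Factorization w).2 := by
  induction w using List.reverseRecOn with
  | nil => exact ⟨rfl, by simp [lz78Factorization], by simp [lz78Factorization],
      by simp [lz78Factorization]⟩
  | append_singleton w a ih =>
    have hstep : lz78Factorization (w ++ [a]) = lz78Step (lz78Factorization w) a := by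
      simp [lz78Factorization]
    rw [hstep]
    generalize lz78Factorization w = s at ih
    obtain ⟨D, p⟩ := s
    obtain ⟨h1, h2, h3, h4⟩ := ih
    simp only at h1 h2 h3 h4
    unfold lz78Step
    split_ifs with h
    · exact ⟨by simp [← h1], h2, h3, List.mem_cons_of_mem _ h⟩
    · simp only at h
      refine ⟨by simp [← h1], ?_, ?_, by simp⟩
      · simp only [← List.cons_append, List.nodup_append, h2, true_and]
        refine ⟨by simp, ?_⟩
        rintro x hx y hy rfl
        simp only [List.mem_singleton] at hy
        subst hy
        simp [h] at hx
      · intro i hi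
        simp only [List.length_append, List.length_singleton] at hi
        rcases Nat.lt_succ_iff_lt_or_eq.mp hi with hi' | rfl
        · simpa [List.getElem_append_left hi', List.take_append_of_le_length hi'.le] using h3 i hi'
        · exact ⟨p, by simpa using h4, a, by simp⟩

/-- The reference to the nonterminal of the factor `f`: the single symbol `F_i` if `f = f_i` is in
the list `D = f₁, …, f_{ℓ-1}`, and no symbol otherwise (as for `f = ε`). The nonterminal `F_i` is
`some` of the position of `f_i` in `D`, and the start nonterminal is `none`. -/
def lz78Ref (D : List (List σ)) (f : List σ) : List (Symbol σ (Option (Fin D.length))) :=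
  if h : f ∈ D then [Symbol.nonterminal (some ⟨D.idxOf f, List.idxOf_lt_length_iff.mpr h⟩)] else []

/-- The productions of the LZ78 grammar: `S → F₁ ⋯ F_{ℓ-1} F` where `F` refers to the last factor
(absent if that is empty); and, where `f_i = f_j a`, the production `F_i → F_j a`, or `F_i → a` if
`f_j` is empty. -/
def lz78Rhs (D : List (List σ)) (p : List σ) :
    Option (Fin D.length) → List (Symbol σ (Option (Fin D.length)))
  | none => (List.finRange D.length).map (fun i => Symbol.nonterminal (some i)) ++ lz78Ref D p
  | some i => lz78Ref D (D[i].dropLast) ++ D[i].getLast?.toList.map Symbol.terminal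

theorem mem_lz78Ref {D : List (List σ)} {f : List σ} {B : Option (Fin D.length)}
    (h : Symbol.nonterminal B ∈ lz78Ref D f) : ∃ i : Fin D.length, B = some i ∧ D[i] = f := by
  unfold lz78Ref at h
  split_ifs at h with hf
  · simp only [List.mem_singleton, Symbol.nonterminal.injEq] at h
    exact ⟨_, h, by simp⟩
  · simp at h

/-- The SLP that LZ78 produces from the factorization `D, p` of the nonempty word `w`. -/
def lz78SLP {w : List σ} (hw : w ≠ []) (D : List (List σ)) (p : List σ)
    (hD : IsLZ78Factorization w D p) : SLP σ where
  N := Option (Fin D.length)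
  start := none
  rhs := lz78Rhs D p
  rhs_ne_nil := by
    rintro (_ | i)
    · intro h
      simp only [lz78Rhs, List.append_eq_nil_iff, List.map_eq_nil_iff,
        List.finRange_eq_nil_iff] at h
      have h0 : D = [] := List.length_eq_zero_iff.mp h.1
      have h1 := hD.last_mem
      have h2 := hD.flatten_eq
      simp only [h0, List.mem_singleton] at h1
      simp [h0, h1] at h2
      exact hw h2
    · have := hD.getElem_ne_nil i
      intro h
      simp only [lz78Rhs, List.append_eq_nil_iff, List.map_eq_nil_iff,
        Option.toList_eq_nil_iff, List.getLast?_eq_none_iff] at h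
      exact this h.2
  acyclic := by
    let μ : Option (Fin D.length) → WithTop ℕ := fun A => match A with
      | none => ⊤
      | some i => (D[i].length : ℕ)
    have key : ∀ A B, Symbol.nonterminal B ∈ lz78Rhs D p A → μ B < μ A := by
      rintro (_ | i) B hB
      · have : ∃ i : Fin D.length, B = some i := by
          simp only [lz78Rhs, List.mem_append, List.mem_map] at hB
          rcases hB with ⟨i, -, hi⟩ | hB
          · simp only [Symbol.nonterminal.injEq] at hi
            exact ⟨i, hi.symm⟩
          · obtain ⟨i, hi, -⟩ := mem_lz78Ref hB
            exact ⟨i, hi⟩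
        obtain ⟨i, rfl⟩ := this
        exact WithTop.coe_lt_top _
      · simp only [lz78Rhs, List.mem_append, List.mem_map, reduceCtorEq, and_false, exists_false,
          or_false] at hB
        obtain ⟨j, rfl, hj⟩ := mem_lz78Ref hB
        have hi := List.length_pos_iff.mpr (hD.getElem_ne_nil i)
        show ((D[j].length : ℕ) : WithTop ℕ) < ((D[i].length : ℕ) : WithTop ℕ)
        rw [hj, List.length_dropLast]
        exact_mod_cast Nat.sub_lt hi one_pos
    intro A hA
    have : ∀ B, Relation.TransGen (fun A B => Symbol.nonterminal B ∈ lz78Rhs D p A) A B →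
        μ B < μ A := by
      intro B hB
      induction hB with
      | single h => exact key _ _ h
      | tail _ h ih => exact (key _ _ h).trans ih
    exact lt_irrefl _ (this A hA)

theorem val_lz78SLP {w : List σ} (hw : w ≠ []) (D : List (List σ)) (p : List σ)
    (hD : IsLZ78Factorization w D p) : (lz78SLP hw D p hD).val = w := by
  obtain ⟨V, hV0, hV⟩ : ∃ V : Option (Fin D.length) → List σ,
      (lz78SLP hw D p hD).val = V none ∧
      ∀ A, V A = (lz78Rhs D p A).flatMap (SLP.symbolVal V) :=
    ⟨(lz78SLP hw D p hD).valOf, rfl, (lz78SLP hw D p hD).valOf_eq⟩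
  have href : ∀ f : List σ, f ∈ [] :: D → (∀ i : Fin D.length, D[i] = f → V (some i) = f) →
      (lz78Ref D f).flatMap (SLP.symbolVal V) = f := by
    intro f hf h
    unfold lz78Ref
    split_ifs with hfD
    · simpa only [List.flatMap_cons, List.flatMap_nil, List.append_nil, SLP.symbolVal] using h ⟨D.idxOf f, List.idxOf_lt_length_iff.mpr hfD⟩ (by simp)
    · rcases List.mem_cons.mp hf with rfl | hf
      · rfl
      · exact absurd hf hfD
  have hF : ∀ (n : ℕ) (i : Fin D.length), D[i].length = n → V (some i) = D[i] := by
    intro n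
    induction n using Nat.strong_induction_on with
    | _ n ih =>
      intro i hi
      have hne := hD.getElem_ne_nil i
      have hpos := List.length_pos_iff.mpr hne
      obtain ⟨f, hf, a, hfa⟩ := hD.extends_earlier i i.2
      have hfa' : D[i] = f ++ [a] := hfa
      have hfm : f ∈ [] :: D := by
        rcases List.mem_cons.mp hf with rfl | hf
        · simp
        · exact List.mem_cons_of_mem _ (List.mem_of_mem_take hf)
      rw [hV]
      show (lz78Ref D (D[i].dropLast) ++ D[i].getLast?.toList.map Symbol.terminal).flatMap
        (SLP.symbolVal V) = D[i]
      rw [hfa']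
      rw [hfa'] at hi
      simp only [List.dropLast_concat, List.getLast?_append, List.getLast?_singleton,
        Option.some_or, Option.toList_some, List.map_cons, List.map_nil, List.flatMap_append]
      rw [href f hfm]
      · simp [SLP.symbolVal]
      · intro j hj
        rw [ih f.length (by simp at hi; omega) j (by rw [hj]), hj]
  rw [hV0]
  rw [hV]
  show ((List.finRange D.length).map (fun i => Symbol.nonterminal (some i)) ++
    lz78Ref D p).flatMap (SLP.symbolVal V) = w
  rw [List.flatMap_append, href p hD.last_mem (fun i hi => by rw [hF _ i rfl, hi]),
    ← hD.flatten_eq, List.flatMap_map]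
  congr 1
  have : (fun i : Fin D.length => (SLP.symbolVal V) (Symbol.nonterminal (some i))) = fun i => D[i] :=
    funext fun i => hF _ i rfl
  rw [this, List.flatMap_def]
  congr 1
  exact List.ext_getElem (by simp) (by simp)

variable (σ) in
/-- The grammar-based compressor LZ78 over the alphabet `σ`. -/
def lz78Compressor : GrammarCompressor σ where
  compress w hw := lz78SLP hw _ _ (isLZ78Factorization_lz78Factorization w)
  val_compress _ hw := val_lz78SLP hw _ _ _

end LZ78

/-- The worst-case approximation ratio of LZ78 over all words of length `n` over an alphabet with
`k` letters. -/
noncomputable def lz78WorstCaseRatio (k n : ℕ) : ℝ :=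
  (lz78Compressor (Fin k)).worstCaseRatio n

/-!
Write `g = g(w)` for the smallest grammar size of a word `w` of length `n` and `F` for the number of
its LZ78 factors; the LZ78 grammar has size `Θ(F)`.

Upper bound. A grammar of size `g` produces a word of length at most `2 ^ g`
(`SLP.length_val_le_two_pow_size`), so `log n ≤ g`. Moreover, every infix of length `ℓ` of `w`
starts inside some symbol of some right-hand side and does not end before that symbol does, so there are at most `g ℓ` such infixes
(`SLP.card_infixes_le`). The factors are distinct infixes of total length at most `n`, hence
`F ≤ g T² + n / T` for every `T ≥ 1` (`IsLZ78Factorization.mul_length_le`). With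
`T ≈ (n / g) ^ (1 / 3)` the ratio is `O((n / g) ^ (2 / 3))`, which is `O((n / log n) ^ (2 / 3))`.

Lower bound. With `m ≈ log n` and `L ≈ (n / log n) ^ (1 / 3)`, the word
`a^(1 + ⋯ + L) (b a^L)^((L+1)²) (b a b a^L b a² b a^L ⋯ b aᵐ b a^L)^((L+1)²)` (`hardWord`) has length
`Θ(n)` and a grammar of size `O(m)` (`exists_wordChain_hardWord`). Its LZ78 factors are first
`a, …, a^L`, then all words `aⁱ b aᶜ`, and then all words `aⁱ (b aʲ b) aᶜ` with `i, c ≤ L` and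
`1 ≤ j ≤ m`, each exactly once, so there are at least `m (L + 1)²` of them. The reason is that LZ78
performs a rotor walk: the state is the separator `zⱼ` that comes next and the number `i` of letters
`a` left before it; the next factor is `aⁱ zⱼ aᶜ`, where `c` is the number of previous visits to this
state, and the next state is `L - c` letters `a` before the next separator. As every state has `L + 1`
outgoing and `L + 1` incoming edges and the rotor order uses the edges into the starting state last,
the walk is an Eulerian circuit (`IsRotorState.eq_of_stuck`). The result is the ratio
`Ω(m (L + 1)² / m)`.
-/

/-! ### Words produced by a straight-line program of a given size -/

namespace SLP

variable {σ : Type} (G : SLP σ)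

/-- Every nonterminal contributes at most one factor: along an occurrence, the set of nonterminals
below strictly shrinks by acyclicity. -/
theorem length_valOf_le_prod [DecidableRel (Relation.ReflTransGen G.Occurs)] (A : G.N) :
    (G.valOf A).length ≤
      ∏ B : G.N with Relation.ReflTransGen G.Occurs B A, (G.rhs B).length := by
  classical
  have hpos : ∀ B, 1 ≤ (G.rhs B).length := fun B => List.length_pos_iff.mpr (G.rhs_ne_nil B)
  induction A using G.wellFounded_occurs.induction with
  | _ A ih =>
  set P := ∏ B : G.N with Relation.TransGen G.Occurs B A, (G.rhs B).length with hP
  have hsum : (G.valOf A).length ≤ (G.rhs A).length * P := by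
    rw [G.valOf_eq, List.length_flatMap]
    refine (List.sum_le_card_nsmul _ P ?_).trans (by simp)
    intro l hl
    obtain ⟨X, hX, rfl⟩ := List.mem_map.mp hl
    rcases X with a | C
    · have : 1 ≤ P := Nat.succ_le_of_lt (Finset.prod_pos fun B _ => hpos B)
      simpa [symbolVal] using this
    · refine (ih C hX).trans (Finset.prod_le_prod_of_subset_of_one_le' ?_ fun B _ _ => hpos B)
      intro B hB
      simp only [Finset.mem_filter, Finset.mem_univ, true_and] at hB ⊢
      exact Relation.TransGen.tail' hB hX
  have hA : A ∉ Finset.univ.filter (fun B => Relation.TransGen G.Occurs B A) := by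
    simp only [Finset.mem_filter, Finset.mem_univ, true_and]
    exact fun h => G.acyclic A (Relation.transGen_swap.mp h)
  refine hsum.trans ?_
  rw [hP, ← Finset.prod_insert hA (f := fun B => (G.rhs B).length)]
  refine Finset.prod_le_prod_of_subset_of_one_le' ?_ fun B _ _ => hpos B
  intro B hB
  simp only [Finset.mem_insert, Finset.mem_filter, Finset.mem_univ, true_and] at hB ⊢
  rcases hB with rfl | hB
  · exact Relation.ReflTransGen.refl
  · exact hB.to_reflTransGen

theorem length_val_le_two_pow_size : G.val.length ≤ 2 ^ G.size := by
  classical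
  refine (G.length_valOf_le_prod G.start).trans ?_
  refine (Finset.prod_le_prod_of_subset_of_one_le' (Finset.filter_subset _ _)
    fun B _ _ => List.length_pos_iff.mpr (G.rhs_ne_nil B)).trans ?_
  rw [size, ← Finset.prod_pow_eq_pow_sum]
  exact Finset.prod_le_prod' fun B _ => Nat.lt_two_pow_self.le

/-- The word of length `ℓ` that starts `d` letters before the end of the value of the `t`-th symbol
on the right-hand side of `B` and extends into the values of the following symbols. -/
noncomputable def crossingWord (ℓ : ℕ) (B : G.N) (t : Fin (G.rhs B).length) (d : ℕ) : List σ :=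
  (symbolVal G.valOf (G.rhs B)[t]).drop ((symbolVal G.valOf (G.rhs B)[t]).length - d) ++
    (((G.rhs B).drop (t + 1)).flatMap (symbolVal G.valOf)).take (ℓ - d)

/-- A nonempty infix of a concatenation of symbol values is an infix of the value of one of the
nonterminals, or it leaves (or, for a terminal, exhausts) the value of the symbol in which it
starts. -/
theorem infix_flatMap_symbolVal {N : Type} (V : N → List σ) {x : List σ} (hx : x ≠ [])
    (R : List (Symbol σ N)) (h : x <:+: R.flatMap (symbolVal V)) :
    (∃ C, Symbol.nonterminal C ∈ R ∧ x <:+: V C) ∨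
    ∃ (t : Fin R.length) (d : Fin x.length), x =
      (symbolVal V R[t]).drop ((symbolVal V R[t]).length - (d + 1)) ++
        ((R.drop (t + 1)).flatMap (symbolVal V)).take (x.length - (d + 1)) := by
  induction R with
  | nil => simp_all
  | cons X R ih =>
    rw [List.flatMap_cons, List.infix_append_iff_ne_nil] at h
    rcases h with h | h | ⟨x₁, x₂, hx₁, -, rfl, hs, hp⟩
    · rcases X with a | C
      · right
        have hxa : x = [a] := by
          simp only [symbolVal] at h
          obtain ⟨s, u, hsu⟩ := h
          rcases s with _ | ⟨s, s'⟩
          · rcases x with _ | ⟨y, x⟩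
            · exact absurd rfl hx
            · simp_all
          · simp_all
        subst hxa
        exact ⟨⟨0, by simp⟩, ⟨0, by simp⟩, by simp [symbolVal]⟩
      · exact Or.inl ⟨C, by simp, h⟩
    · rcases ih h with ⟨C, hC, hxC⟩ | ⟨t, d, htd⟩
      · exact Or.inl ⟨C, by simp [hC], hxC⟩
      · exact Or.inr ⟨t.succ, d, by simpa using htd⟩
    · right
      have h1 := List.length_pos_iff.mpr hx₁
      refine ⟨⟨0, by simp⟩, ⟨x₁.length - 1, by simp; omega⟩, ?_⟩
      have e : x₁.length - 1 + 1 = x₁.length := by omega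
      simp only [e]
      rw [List.suffix_iff_eq_drop] at hs
      rw [List.prefix_iff_eq_take] at hp
      simp only [List.length_append, Nat.add_sub_cancel_left]
      simpa using congrArg₂ (· ++ ·) hs hp

theorem exists_eq_crossingWord {x : List σ} (hx : x ≠ []) (A : G.N) (h : x <:+: G.valOf A) :
    ∃ (B : G.N) (t : Fin (G.rhs B).length) (d : Fin x.length),
      x = G.crossingWord x.length B t (d + 1) := by
  induction A using G.wellFounded_occurs.induction with
  | _ A ih =>
  rw [G.valOf_eq] at h
  rcases infix_flatMap_symbolVal G.valOf hx _ h with ⟨C, hC, hxC⟩ | ⟨t, d, htd⟩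
  · exact ih C hC hxC
  · exact ⟨A, t, d, htd⟩

/-- A word produced by a small grammar has few distinct infixes of each length, since every one of
them is determined by a symbol of a right-hand side and by the number of letters, between `1` and `ℓ`,
that it takes from the end of the value of this symbol. -/
theorem card_infixes_le (S : Finset (List σ)) {ℓ : ℕ} (hℓ : ℓ ≠ 0)
    (hS : ∀ x ∈ S, x.length = ℓ ∧ x <:+: G.val) : S.card ≤ G.size * ℓ := by
  classical
  have hsub : S ⊆ (Finset.univ : Finset ((Σ B : G.N, Fin (G.rhs B).length) × Fin ℓ)).image
      (fun q => G.crossingWord ℓ q.1.1 q.1.2 (q.2 + 1)) := by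
    intro x hx
    obtain ⟨rfl, hxv⟩ := hS x hx
    obtain ⟨B, t, d, h⟩ := G.exists_eq_crossingWord (by rintro rfl; simp at hℓ) G.start hxv
    exact Finset.mem_image.mpr ⟨(⟨B, t⟩, d), Finset.mem_univ _, h.symm⟩
  refine (Finset.card_le_card hsub).trans (Finset.card_image_le.trans ?_)
  simp [size, Fintype.card_sigma]

end SLP

section SmallestGrammar

variable {σ : Type}

theorem smallestSLPSize_le (G : SLP σ) : smallestSLPSize G.val ≤ G.size :=
  Nat.sInf_le ⟨G, rfl, rfl⟩

theorem exists_slp_of_size_eq [DecidableEq σ] {w : List σ} (hw : w ≠ []) :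
    ∃ G : SLP σ, G.val = w ∧ G.size = smallestSLPSize w :=
  Nat.sInf_mem (s := {s | ∃ G : SLP σ, G.val = w ∧ G.size = s})
    ⟨_, _, (lz78Compressor σ).val_compress w hw, rfl⟩

theorem log_length_le_smallestSLPSize [DecidableEq σ] {w : List σ} (hw : w ≠ []) :
    Real.log w.length ≤ smallestSLPSize w := by
  obtain ⟨G, rfl, hG⟩ := exists_slp_of_size_eq hw
  rw [← hG]
  have hpos : (0 : ℝ) < G.val.length := by exact_mod_cast List.length_pos_iff.mpr hw
  calc Real.log G.val.length ≤ Real.log ((2 : ℝ) ^ G.size) :=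
        Real.log_le_log hpos (by exact_mod_cast G.length_val_le_two_pow_size)
    _ = G.size * Real.log 2 := Real.log_pow _ _
    _ ≤ G.size * 1 := by
        gcongr
        linarith [Real.log_two_lt_d9]
    _ = G.size := mul_one _

end SmallestGrammar

/-! ### The number of LZ78 factors and the size of the LZ78 grammar -/

section Factors

variable {σ : Type}

/-- Factors of length at most `T` are few because the word has few infixes of small length; factors
longer than `T` are few because of the total length. -/
theorem IsLZ78Factorization.mul_length_le {w : List σ} {D : List (List σ)} {p : List σ}
    (hD : IsLZ78Factorization w D p) (G : SLP σ) (hG : G.val = w) (T : ℕ) :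
    T * D.length ≤ G.size * T ^ 3 + w.length := by
  classical
  have hnd : D.Nodup := (List.nodup_cons.mp hD.nodup).2
  have hne : ∀ x ∈ D, x ≠ [] := fun x hx h => (List.nodup_cons.mp hD.nodup).1 (h ▸ hx)
  have hinf : ∀ x ∈ D, x <:+: w := fun x hx => by
    rw [← hD.flatten_eq]
    exact (List.infix_of_mem_flatten hx).trans (List.prefix_append _ _).isInfix
  have hsum : ∑ x ∈ D.toFinset, x.length ≤ w.length := by
    rw [List.sum_toFinset _ hnd, ← hD.flatten_eq]
    simp
  have hcard : D.length = D.toFinset.card := (List.toFinset_card_of_nodup hnd).symm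
  have hshort : (D.toFinset.filter (fun x => x.length ≤ T)).card ≤ G.size * T ^ 2 := by
    rw [Finset.card_eq_sum_card_fiberwise (f := List.length) (t := Finset.Icc 1 T)]
    · calc _ ≤ ∑ ℓ ∈ Finset.Icc 1 T, G.size * T := by
            refine Finset.sum_le_sum fun ℓ hℓ => ?_
            rw [Finset.mem_Icc] at hℓ
            refine (G.card_infixes_le _ (by omega) ?_).trans (Nat.mul_le_mul_left _ hℓ.2)
            intro x hx
            simp only [Finset.mem_filter, List.mem_toFinset] at hx
            exact ⟨hx.2, hG ▸ hinf x hx.1.1⟩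
        _ = G.size * T ^ 2 := by simp; ring
    · intro x hx
      simp only [Finset.coe_filter, List.mem_toFinset, Set.mem_ofPred_eq, Finset.coe_Icc,
        Set.mem_Icc] at hx ⊢
      exact ⟨List.length_pos_iff.mpr (hne x hx.1), hx.2⟩
  have hlong : T * (D.toFinset.filter (fun x => ¬ x.length ≤ T)).card ≤ w.length := by
    refine le_trans ?_ hsum
    refine le_trans ?_ (Finset.sum_le_sum_of_subset (Finset.filter_subset (fun x => ¬ x.length ≤ T) _))
    rw [mul_comm]
    refine Finset.card_nsmul_le_sum _ _ _ fun x hx => ?_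
    simp only [Finset.mem_filter] at hx
    omega
  rw [hcard, ← Finset.card_filter_add_card_filter_not (fun x : List σ => x.length ≤ T), mul_add]
  refine add_le_add ?_ hlong
  calc _ ≤ T * (G.size * T ^ 2) := Nat.mul_le_mul_left _ hshort
    _ = _ := by ring

theorem IsLZ78Factorization.length_le {w : List σ} {D : List (List σ)} {p : List σ}
    (hD : IsLZ78Factorization w D p) : D.length ≤ w.length := by
  rw [← hD.flatten_eq, List.length_append, List.length_flatten]
  refine le_trans ?_ (Nat.le_add_right _ _)
  calc D.length = (D.map List.length).length • 1 := by simp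
    _ ≤ _ := List.card_nsmul_le_sum _ _ ?_
  intro l hl
  obtain ⟨x, hx, rfl⟩ := List.mem_map.mp hl
  exact List.length_pos_iff.mpr fun h => (List.nodup_cons.mp hD.nodup).1 (h ▸ hx)

theorem IsLZ78Factorization.length_pos {w : List σ} {D : List (List σ)} {p : List σ}
    (hD : IsLZ78Factorization w D p) (hw : w ≠ []) : 0 < D.length := by
  refine List.length_pos_iff.mpr ?_
  rintro rfl
  have h1 := hD.last_mem
  have h2 := hD.flatten_eq
  simp_all

variable [DecidableEq σ]

theorem length_lz78Ref_le (D : List (List σ)) (f : List σ) : (lz78Ref D f).length ≤ 1 := by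
  unfold lz78Ref
  split_ifs <;> simp

theorem size_lz78SLP_le {w : List σ} (hw : w ≠ []) (D : List (List σ)) (p : List σ)
    (hD : IsLZ78Factorization w D p) : (lz78SLP hw D p hD).size ≤ 4 * D.length := by
  have h0 : (lz78SLP hw D p hD).size =
      ∑ A : Option (Fin D.length), (lz78Rhs D p A).length := by
    unfold SLP.size
    refine Fintype.sum_equiv (Equiv.refl _) _ _ fun _ => rfl
  have hpos := hD.length_pos hw
  have hnone : (lz78Rhs D p none).length ≤ D.length + 1 := by
    simpa [lz78Rhs] using length_lz78Ref_le D p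
  have hsome : ∑ i : Fin D.length, (lz78Rhs D p (some i)).length ≤ D.length * 2 := by
    refine (Finset.sum_le_card_nsmul _ _ 2 fun i _ => ?_).trans (by simp)
    have h1 := length_lz78Ref_le D (D[i].dropLast)
    have h2 : (D[i].getLast?.toList).length ≤ 1 := by
      cases D[i].getLast? <;> simp
    simp only [lz78Rhs, List.length_append, List.length_map]
    omega
  rw [h0, Fintype.sum_option]
  omega

theorem length_le_size_lz78SLP {w : List σ} (hw : w ≠ []) (D : List (List σ)) (p : List σ)
    (hD : IsLZ78Factorization w D p) : D.length ≤ (lz78SLP hw D p hD).size := by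
  have h0 : (lz78SLP hw D p hD).size =
      ∑ A : Option (Fin D.length), (lz78Rhs D p A).length := by
    unfold SLP.size
    refine Fintype.sum_equiv (Equiv.refl _) _ _ fun _ => rfl
  rw [h0, Fintype.sum_option]
  refine le_trans ?_ (Nat.le_add_right _ _)
  simp [lz78Rhs]

end Factors

/-! ### The upper bound -/

section UpperBound

variable {σ : Type} [DecidableEq σ]

theorem lz78_ratio_le {w : List σ} (hw : w ≠ []) (hn : 2 ≤ w.length) :
    (lz78Compressor σ).ratio w hw ≤
      20 * ((w.length : ℝ) / Real.log w.length) ^ (2 / 3 : ℝ) := by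
  have hD := isLZ78Factorization_lz78Factorization w
  set F := (lz78Factorization w).1.length with hF
  set n := w.length with hnw
  obtain ⟨G, hGw, hGs⟩ := exists_slp_of_size_eq hw
  set g := smallestSLPSize w with hg
  have hsize : (((lz78Compressor σ).compress w hw).size : ℝ) ≤ 4 * F := by
    exact_mod_cast size_lz78SLP_le hw _ _ hD
  have hn0 : (0 : ℝ) < n := by exact_mod_cast (by omega : 0 < n)
  have hlog : 0 < Real.log n := Real.log_pos (by exact_mod_cast hn)
  have hlg : Real.log n ≤ g := log_length_le_smallestSLPSize hw
  have hg0 : (0 : ℝ) < g := hlog.trans_le hlg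
  unfold GrammarCompressor.ratio
  rw [← hg, div_le_iff₀ hg0]
  refine hsize.trans ?_
  by_cases hgn : n < g
  · have h1 : (1 : ℝ) ≤ ((n : ℝ) / Real.log n) ^ (2 / 3 : ℝ) := by
      refine Real.one_le_rpow ?_ (by norm_num)
      rw [one_le_div hlog]
      exact Real.log_le_self hn0.le
    have h2 : (F : ℝ) ≤ g := by exact_mod_cast hD.length_le.trans hgn.le
    nlinarith
  · -- the threshold `T ≈ (n / g) ^ (1 / 3)` balances short against long factors
    have hx1 : 1 ≤ (n : ℝ) / g := by
      rw [one_le_div hg0]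
      exact_mod_cast not_lt.mp hgn
    set x : ℝ := ((n : ℝ) / g) ^ (1 / 3 : ℝ) with hx
    have hx1' : 1 ≤ x := Real.one_le_rpow hx1 (by norm_num)
    have hx0 : 0 < x := by linarith
    have hx3 : x ^ 3 * g = n := by
      rw [hx, ← Real.rpow_natCast, ← Real.rpow_mul (by positivity)]
      norm_num
      field_simp
    have hx2 : x ^ 2 ≤ ((n : ℝ) / Real.log n) ^ (2 / 3 : ℝ) := by
      rw [hx, ← Real.rpow_natCast, ← Real.rpow_mul (by positivity)]
      norm_num
      gcongr
    set T := ⌈x⌉₊ with hT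
    have hT1 : x ≤ T := Nat.le_ceil x
    have hT2 : (T : ℝ) ≤ 2 * x := by
      have := Nat.ceil_lt_add_one hx0.le
      linarith
    have hTpos : (0 : ℝ) < T := by linarith
    have hmain : (T : ℝ) * F ≤ g * T ^ 3 + n := by
      have := hD.mul_length_le G hGw T
      rw [hGs] at this
      exact_mod_cast this
    have h1 : (T : ℝ) * F ≤ T * (5 * (g * x ^ 2)) := by
      have e1 : (g : ℝ) * T ^ 3 ≤ T * (4 * (g * x ^ 2)) := by
        have : (T : ℝ) ^ 2 ≤ (2 * x) ^ 2 := by gcongr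
        nlinarith [mul_le_mul_of_nonneg_left this (mul_pos hg0 hTpos).le]
      have e2 : (n : ℝ) ≤ T * (g * x ^ 2) := by
        rw [← hx3]
        nlinarith [mul_le_mul_of_nonneg_right hT1 (mul_pos hg0 (pow_pos hx0 2)).le]
      linarith
    have h2 : (F : ℝ) ≤ 5 * (g * x ^ 2) := le_of_mul_le_mul_left h1 hTpos
    nlinarith [mul_le_mul_of_nonneg_left hx2 hg0.le]

/-- The grammar produced by LZ78 is itself a grammar for the word. -/
theorem one_le_lz78_ratio {w : List σ} (hw : w ≠ []) (hn : 2 ≤ w.length) :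
    1 ≤ (lz78Compressor σ).ratio w hw := by
  have hlog : 0 < Real.log w.length := Real.log_pos (by exact_mod_cast hn)
  have hg0 := hlog.trans_le (log_length_le_smallestSLPSize hw)
  unfold GrammarCompressor.ratio
  rw [one_le_div hg0]
  have := smallestSLPSize_le ((lz78Compressor σ).compress w hw)
  rw [(lz78Compressor σ).val_compress w hw] at this
  exact_mod_cast this

end UpperBound

/-! ### Grammars from chains of concatenations -/

/-- A list of words, most recent first, each of which is a single letter or the concatenation of two
words that are already in the list. -/
inductive WordChain {σ : Type} : List (List σ) → Prop
  | nil : WordChain []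
  | letter {l : List (List σ)} (hl : WordChain l) (a : σ) : WordChain ([a] :: l)
  | concat {l : List (List σ)} (hl : WordChain l) {x y : List σ} (hx : x ∈ l) (hy : y ∈ l) :
      WordChain ((x ++ y) :: l)

namespace WordChain

variable {σ : Type} {l : List (List σ)}

theorem exists_rhs (hl : WordChain l) (i : Fin l.length) :
    ∃ r : List (Symbol σ (Fin l.length)), r ≠ [] ∧ r.length ≤ 2 ∧
      (∀ j, Symbol.nonterminal j ∈ r → i < j) ∧ r.flatMap (SLP.symbolVal l.get) = l.get i := by
  have key : (∃ a, l.get i = [a]) ∨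
      ∃ j k, i < j ∧ i < k ∧ l.get i = l.get j ++ l.get k := by
    induction hl with
    | nil => exact i.elim0
    | letter hl a ih =>
      refine Fin.cases (Or.inl ⟨a, rfl⟩) (fun i => ?_) i
      rcases ih i with ⟨c, h⟩ | ⟨j, k, hj, hk, h⟩
      · exact Or.inl ⟨c, h⟩
      · exact Or.inr ⟨j.succ, k.succ, by simpa using hj, by simpa using hk, h⟩
    | concat hl hx hy ih =>
      refine Fin.cases (Or.inr ?_) (fun i => ?_) i
      · obtain ⟨j, rfl⟩ := List.get_of_mem hx
        obtain ⟨k, rfl⟩ := List.get_of_mem hy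
        exact ⟨j.succ, k.succ, by simp, by simp, rfl⟩
      rcases ih i with ⟨c, h⟩ | ⟨j, k, hj, hk, h⟩
      · exact Or.inl ⟨c, h⟩
      · exact Or.inr ⟨j.succ, k.succ, by simpa using hj, by simpa using hk, h⟩
  rcases key with ⟨a, h⟩ | ⟨j, k, hj, hk, h⟩
  · exact ⟨[Symbol.terminal a], by simp, by simp, by simp, by rw [h]; rfl⟩
  · refine ⟨[Symbol.nonterminal j, Symbol.nonterminal k], by simp, by simp, ?_, ?_⟩
    · rintro t ht
      simp only [List.mem_cons, Symbol.nonterminal.injEq, List.not_mem_nil, or_false] at ht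
      rcases ht with rfl | rfl <;> assumption
    · rw [h]
      simp [SLP.symbolVal]

/-- A chain is a grammar with one nonterminal for each of its words. -/
theorem smallestSLPSize_le (hl : WordChain l) {w : List σ} (hw : w ∈ l) :
    smallestSLPSize w ≤ 2 * l.length := by
  choose r hne hlen hlt hval using hl.exists_rhs
  obtain ⟨s, rfl⟩ := List.get_of_mem hw
  let G : SLP σ :=
    { N := Fin l.length
      start := s
      rhs := r
      rhs_ne_nil := hne
      acyclic := by
        have : ∀ i j, Relation.TransGen (fun A B => Symbol.nonterminal B ∈ r A) i j → i < j := by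
          intro i j h
          induction h with
          | single h => exact hlt _ _ h
          | tail _ h ih => exact ih.trans (hlt _ _ h)
        exact fun A h => lt_irrefl _ (this A A h) }
  have hG : ∀ A : G.N, G.valOf A = l.get A := by
    intro A
    induction A using G.wellFounded_occurs.induction with
    | _ A ih =>
    rw [G.valOf_eq, ← hval A]
    refine List.flatMap_congr fun X hX => ?_
    rcases X with a | B
    · rfl
    · exact ih B hX
  have hs : G.val = l.get s := hG s
  rw [← hs]
  refine (_root_.smallestSLPSize_le G).trans ?_
  have : G.size = ∑ i : Fin l.length, (r i).length := by
    unfold SLP.size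
    exact Fintype.sum_equiv (Equiv.refl _) _ _ fun _ => rfl
  rw [this]
  exact (Finset.sum_le_card_nsmul _ _ 2 fun i _ => hlen i).trans (by simp; omega)

/-- Powers are formed by repeated squaring. -/
theorem exists_pow (hl : WordChain l) {w : List σ} (hw : w ∈ l) {n : ℕ} (hn : n ≠ 0) :
    ∃ l', WordChain l' ∧ l ⊆ l' ∧ (List.replicate n w).flatten ∈ l' ∧
      l'.length ≤ l.length + 2 * Nat.log 2 n := by
  induction n using Nat.strong_induction_on with
  | _ n ih =>
  by_cases h1 : n = 1
  · subst h1
    exact ⟨l, hl, List.Subset.refl _, by simpa using hw, by simp⟩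
  obtain ⟨l', hl', hsub, hmem, hlen⟩ := ih (n / 2) (by omega) (by omega)
  have hlog : Nat.log 2 n = Nat.log 2 (n / 2) + 1 := by
    rw [Nat.log_div_base]
    have : 1 ≤ Nat.log 2 n := Nat.log_pos (by norm_num) (by omega)
    omega
  set q := n / 2 with hq
  have hsq : (List.replicate q w).flatten ++ (List.replicate q w).flatten =
      (List.replicate (q + q) w).flatten := by
    rw [← List.flatten_append, List.replicate_append_replicate]
  rcases Nat.mod_two_eq_zero_or_one n with h | h
  · refine ⟨_, hl'.concat hmem hmem, fun x hx => List.mem_cons_of_mem _ (hsub hx), ?_, ?_⟩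
    · rw [hsq, show q + q = n by omega]
      exact List.mem_cons_self
    · simp only [List.length_cons]
      omega
  · refine ⟨_, (hl'.concat hmem hmem).concat (List.mem_cons_of_mem _ (hsub hw))
      List.mem_cons_self,
      fun x hx => List.mem_cons_of_mem _ (List.mem_cons_of_mem _ (hsub hx)), ?_, ?_⟩
    · rw [hsq, ← List.flatten_cons, ← List.replicate_succ, show q + q + 1 = n by omega]
      exact List.mem_cons_self
    · simp only [List.length_cons]
      omega

theorem exists_replicate (hl : WordChain l) {a : σ} (ha : [a] ∈ l) {n : ℕ} (hn : n ≠ 0) :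
    ∃ l', WordChain l' ∧ l ⊆ l' ∧ List.replicate n a ∈ l' ∧
      l'.length ≤ l.length + 2 * Nat.log 2 n := by
  have := hl.exists_pow ha hn
  rwa [List.flatten_replicate_singleton] at this

end WordChain

/-! ### The words with many LZ78 factors -/

section HardWords

variable {σ : Type} (a b : σ)

/-- The word `b aʲ⁺¹ b`, which separates runs of `a`. -/
def separator (j : ℕ) : List σ := b :: (List.replicate (j + 1) a ++ [b])

/-- The word `(b a b) a^L (b a² b) a^L ⋯ (b aᵐ b) a^L`. -/
def separatedRuns (L m : ℕ) : List σ :=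
  (List.range m).flatMap fun j => separator a b j ++ List.replicate L a

/-- The word `a^(1 + ⋯ + L) (b a^L)^((L+1)²) (b a b a^L b a² b a^L ⋯ b aᵐ b a^L)^((L+1)²)`. -/
def hardWord (L m : ℕ) : List σ :=
  List.replicate (∑ i ∈ Finset.range (L + 1), i) a ++
    ((List.replicate ((L + 1) ^ 2) (b :: List.replicate L a)).flatten ++
      (List.replicate ((L + 1) ^ 2) (separatedRuns a b L m)).flatten)

theorem separatedRuns_succ (L m : ℕ) : separatedRuns a b L (m + 1) =
    separatedRuns a b L m ++ (separator a b m ++ List.replicate L a) := by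
  simp [separatedRuns, List.range_succ]

variable {a b}

theorem WordChain.exists_separatedRuns {l : List (List σ)} (hl : WordChain l) (ha : [a] ∈ l)
    (hb : [b] ∈ l) {L : ℕ} (hv : b :: List.replicate L a ∈ l) (m : ℕ) :
    ∃ l', WordChain l' ∧ l ⊆ l' ∧ List.replicate (m + 1) a ∈ l' ∧
      separatedRuns a b L (m + 1) ∈ l' ∧ l'.length ≤ l.length + 4 * (m + 1) := by
  have hz : ∀ j, ([b] ++ List.replicate (j + 1) a) ++ (b :: List.replicate L a) =
      separator a b j ++ List.replicate L a := fun j => by simp [separator]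
  induction m with
  | zero =>
    refine ⟨_, (hl.concat hb ha).concat List.mem_cons_self (List.mem_cons_of_mem _ hv),
      fun x hx => List.mem_cons_of_mem _ (List.mem_cons_of_mem _ hx), ?_, ?_, ?_⟩
    · simp [ha]
    · have : separatedRuns a b L 1 = [b] ++ [a] ++ (b :: List.replicate L a) := by
        simp [separatedRuns, separator]
      rw [zero_add, this]
      exact List.mem_cons_self
    · simp only [List.length_cons]
      omega
  | succ m ih =>
    obtain ⟨l', hl', hsub, hrep, hmem, hlen⟩ := ih
    have h1 := hl'.concat hrep (hsub ha)
    have h2 := h1.concat (List.mem_cons_of_mem _ (hsub hb)) List.mem_cons_self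
    have h3 := h2.concat List.mem_cons_self
      (List.mem_cons_of_mem _ (List.mem_cons_of_mem _ (hsub hv)))
    have h4 := h3.concat (List.mem_cons_of_mem _ (List.mem_cons_of_mem _
      (List.mem_cons_of_mem _ hmem))) List.mem_cons_self
    have e : List.replicate (m + 1) a ++ [a] = List.replicate (m + 1 + 1) a :=
      List.replicate_succ'.symm
    rw [e, hz, ← separatedRuns_succ] at h4
    refine ⟨_, h4, fun x hx => ?_, ?_, List.mem_cons_self, ?_⟩
    · simp [hsub hx]
    · simp
    · simp only [List.length_cons]
      omega

theorem exists_wordChain_hardWord (a b : σ) {L m : ℕ} (hL : L ≠ 0) (hm : m ≠ 0) (q : ℕ) :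
    ∃ l, WordChain l ∧ hardWord a b L m ++ List.replicate q a ∈ l ∧
      l.length ≤ 6 + 4 * m + 10 * Nat.log 2 (hardWord a b L m ++ List.replicate q a).length := by
  set N := (hardWord a b L m ++ List.replicate q a).length with hN
  have hNval : N = (∑ i ∈ Finset.range (L + 1), i) + ((L + 1) ^ 2 * (L + 1) +
      (L + 1) ^ 2 * (separatedRuns a b L m).length) + q := by
    simp only [hN, hardWord, List.length_append, List.length_replicate, List.length_flatten,
      List.map_replicate, List.sum_replicate, List.length_cons, smul_eq_mul]
  have hlog : ∀ t, t ≤ N → Nat.log 2 t ≤ Nat.log 2 N := fun t ht => Nat.log_mono_right ht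
  have hT : L ≤ ∑ i ∈ Finset.range (L + 1), i :=
    Finset.single_le_sum (f := fun i => i) (fun _ _ => Nat.zero_le _) (by simp)
  have hu : 1 ≤ (separatedRuns a b L m).length := by
    obtain ⟨m, rfl⟩ := Nat.exists_eq_succ_of_ne_zero hm
    rw [Nat.succ_eq_add_one, separatedRuns_succ]
    simp [separator]
    omega
  have hKN : (L + 1) ^ 2 ≤ N := by
    have := Nat.mul_le_mul_left ((L + 1) ^ 2) hu
    rw [mul_one] at this
    omega
  have c0 : WordChain [[b], [a]] := (WordChain.nil.letter a).letter b
  obtain ⟨l1, c1, s1, h1, n1⟩ := c0.exists_replicate (a := a) (by simp) (n := L) hL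
  have c2 := c1.concat (x := [b]) (s1 (by simp)) h1
  obtain ⟨l3, c3, s3, h3, n3⟩ := c2.exists_replicate (a := a)
    (List.mem_cons_of_mem _ (s1 (by simp))) (n := ∑ i ∈ Finset.range (L + 1), i) (by omega)
  obtain ⟨l4, c4, s4, h4, n4⟩ := c3.exists_pow (w := b :: List.replicate L a)
    (s3 (by simp)) (n := (L + 1) ^ 2) (by positivity)
  obtain ⟨m', rfl⟩ := Nat.exists_eq_succ_of_ne_zero hm
  obtain ⟨l5, c5, s5, -, h5, n5⟩ := c4.exists_separatedRuns (a := a) (b := b) (L := L)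
    (s4 (s3 (List.mem_cons_of_mem _ (s1 (by simp)))))
    (s4 (s3 (List.mem_cons_of_mem _ (s1 (by simp)))))
    (s4 (s3 (by simp))) m'
  obtain ⟨l6, c6, s6, h6, n6⟩ := c5.exists_pow h5 (n := (L + 1) ^ 2) (by positivity)
  have c7 := c6.concat (s6 (s5 h4)) h6
  have c8 := c7.concat (List.mem_cons_of_mem _ (s6 (s5 (s4 h3)))) List.mem_cons_self
  have b1 := hlog L (by omega)
  have b2 := hlog (∑ i ∈ Finset.range (L + 1), i) (by omega)
  have b3 := hlog ((L + 1) ^ 2) hKN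
  have b4 := hlog q (by omega)
  simp only [List.length_cons, List.length_nil] at n1 n3
  by_cases hq : q = 0
  · refine ⟨_, c8, ?_, ?_⟩
    · subst hq
      simp [hardWord]
    · simp only [List.length_cons]
      omega
  · obtain ⟨l9, c9, s9, h9, n9⟩ := c8.exists_replicate (a := a)
      (List.mem_cons_of_mem _ (List.mem_cons_of_mem _ (s6 (s5 (s4 (s3
        (List.mem_cons_of_mem _ (s1 (by simp))))))))) (n := q) hq
    refine ⟨_, c9.concat (s9 List.mem_cons_self) h9, List.mem_cons_self, ?_⟩
    simp only [List.length_cons] at n9 ⊢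
    omega

end HardWords

/-! ### Rotor walks -/

section Rotor

variable {m L : ℕ} [NeZero m]

/-- The walk on `ZMod m × Fin (L + 1)` that leaves the vertex `(j, i)` for the `c`-th time, counting
from zero, towards `(j + 1, L - c)`. Here `cnt v` is the number of times that the vertex `v` has been
left, `cur` is the current vertex, and `t` is the number of steps since the start at `0`. The edges
used so far form a walk from `0` to `cur`, which is expressed by the balance `flow` of outgoing and
incoming edges at each vertex. -/
structure IsRotorState (cnt : ZMod m × Fin (L + 1) → ℕ) (cur : ZMod m × Fin (L + 1)) (t : ℕ) :
    Prop where
  le : ∀ v, cnt v ≤ L + 1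
  sum_eq : ∑ v, cnt v = t
  phase : cur.1 = t
  flow : ∀ v, cnt v + (if v = cur then 1 else 0) =
    (Finset.univ.filter fun i : Fin (L + 1) => (v.2.rev : ℕ) < cnt (v.1 - 1, i)).card +
      (if v = 0 then 1 else 0)

namespace IsRotorState

variable {cnt : ZMod m × Fin (L + 1) → ℕ} {cur : ZMod m × Fin (L + 1)} {t : ℕ}

theorem init : IsRotorState (fun _ => 0) (0 : ZMod m × Fin (L + 1)) 0 :=
  ⟨by simp, by simp, by simp, by simp⟩

theorem step (h : IsRotorState cnt cur t) (hlt : cnt cur < L + 1) :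
    IsRotorState (Function.update cnt cur (cnt cur + 1))
      (cur.1 + 1, Fin.rev ⟨cnt cur, hlt⟩) (t + 1) := by
  have hupd : ∀ v, Function.update cnt cur (cnt cur + 1) v =
      cnt v + if v = cur then 1 else 0 := by
    intro v
    by_cases hv : v = cur
    · subst hv; simp
    · simp [hv]
  refine ⟨fun v => ?_, ?_, ?_, fun v => ?_⟩
  · rw [hupd]
    split_ifs with hv
    · subst hv; omega
    · exact h.le v
  · simp only [hupd, Finset.sum_add_distrib, h.sum_eq]
    simp
  · simp [h.phase]
  · -- the new edge is the only new edge into the new vertex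
    have hin : ∀ i : Fin (L + 1),
        (if (v.2.rev : ℕ) < Function.update cnt cur (cnt cur + 1) (v.1 - 1, i) then 1 else 0) =
        (if (v.2.rev : ℕ) < cnt (v.1 - 1, i) then 1 else 0) +
          if i = cur.2 then (if v = (cur.1 + 1, Fin.rev ⟨cnt cur, hlt⟩) then 1 else 0) else 0 := by
      intro i
      have hv : v = (cur.1 + 1, Fin.rev ⟨cnt cur, hlt⟩) ↔
          v.1 - 1 = cur.1 ∧ (v.2.rev : ℕ) = cnt cur := by
        rw [Prod.ext_iff, sub_eq_iff_eq_add, ← Fin.rev_inj (i := v.2), Fin.rev_rev, Fin.ext_iff]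
      have hc : (v.1 - 1, i) = cur ↔ v.1 - 1 = cur.1 ∧ i = cur.2 := Prod.ext_iff
      rw [hupd]
      by_cases h1 : v.1 - 1 = cur.1
      · by_cases h2 : i = cur.2
        · have e : (v.1 - 1, i) = cur := hc.mpr ⟨h1, h2⟩
          rw [e]
          simp only [if_true, h2, hv, h1, true_and]
          split_ifs <;> omega
        · simp [hc, h2]
      · simp [hc, hv, h1]
    rw [hupd, Finset.card_filter, Finset.sum_congr rfl fun i _ => hin i, Finset.sum_add_distrib,
      ← Finset.card_filter, Finset.sum_ite_eq' Finset.univ cur.2, if_pos (Finset.mem_univ _),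
      h.flow v]
    ring

/-- A vertex with all outgoing edges used can only be entered once more if it is the start, because
in- and outdegree agree. Then all edges into the start have been used; as these are the last edges
of their sources, these sources are exhausted as well, and so on backwards. -/
theorem eq_of_stuck (h : IsRotorState cnt cur t) (hcur : cnt cur = L + 1)
    (v : ZMod m × Fin (L + 1)) : cnt v = L + 1 := by
  have hcard : ∀ s : Finset (Fin (L + 1)), s.card ≤ L + 1 := fun s => by
    simpa using Finset.card_le_univ s
  have hcur0 : cur = 0 := by
    by_contra h0
    have := h.flow cur
    rw [if_pos rfl, if_neg h0, hcur] at this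
    have := hcard (Finset.univ.filter fun i => (cur.2.rev : ℕ) < cnt (cur.1 - 1, i))
    omega
  have hbal : ∀ v, cnt v =
      (Finset.univ.filter fun i : Fin (L + 1) => (v.2.rev : ℕ) < cnt (v.1 - 1, i)).card := by
    intro v
    have := h.flow v
    rw [hcur0] at this
    omega
  have hback : ∀ j : ZMod m, cnt (j, 0) = L + 1 → ∀ i, cnt (j - 1, i) = L + 1 := by
    intro j hj i
    rw [hbal] at hj
    have huniv := Finset.eq_univ_of_card _ (hj.trans (by simp))
    have hi := Finset.mem_univ i
    rw [← huniv] at hi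
    simp only [Finset.mem_filter, Finset.mem_univ, true_and, Fin.rev_zero, Fin.val_last] at hi
    have := h.le (j - 1, i)
    omega
  have hall : ∀ n : ℕ, ∀ i, cnt (-(n : ZMod m) - 1, i) = L + 1 := by
    intro n
    induction n with
    | zero =>
      refine hback _ ?_
      rw [hcur0] at hcur
      simp only [Nat.cast_zero, neg_zero]
      exact hcur
    | succ n ih =>
      intro i
      have := hback _ (ih 0) i
      rwa [show -((n + 1 : ℕ) : ZMod m) - 1 = -(n : ZMod m) - 1 - 1 by push_cast; ring]
  obtain ⟨n, hn⟩ := ZMod.natCast_zmod_surjective (-v.1 - 1)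
  have := hall n v.2
  rw [hn] at this
  simpa using this

theorem sum_const : ∑ _v : ZMod m × Fin (L + 1), (L + 1) = m * (L + 1) ^ 2 := by
  simp [ZMod.card]
  ring

theorem lt_of_lt (h : IsRotorState cnt cur t) (ht : t < m * (L + 1) ^ 2) : cnt cur < L + 1 := by
  by_contra hcur
  have hall := h.eq_of_stuck (le_antisymm (h.le cur) (not_lt.mp hcur))
  have := h.sum_eq
  rw [Finset.sum_congr rfl fun v _ => hall v, sum_const] at this
  omega

theorem eq_of_complete (h : IsRotorState cnt cur (m * (L + 1) ^ 2)) (v : ZMod m × Fin (L + 1)) :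
    cnt v = L + 1 := by
  by_contra hv
  have := Finset.sum_lt_sum (fun v _ => h.le v)
    ⟨v, Finset.mem_univ v, lt_of_le_of_ne (h.le v) hv⟩
  rw [h.sum_eq, sum_const] at this
  exact lt_irrefl _ this

theorem cur_of_complete (h : IsRotorState cnt cur (m * (L + 1) ^ 2)) : cur = 0 := by
  by_contra h0
  have := h.flow cur
  rw [if_pos rfl, if_neg h0, h.eq_of_complete] at this
  have : (Finset.univ.filter fun i => (cur.2.rev : ℕ) < cnt (cur.1 - 1, i)).card ≤ L + 1 := by
    simpa using Finset.card_le_univ (Finset.univ.filter fun i => (cur.2.rev : ℕ) < cnt (cur.1 - 1, i))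
  omega

end IsRotorState

end Rotor

/-! ### LZ78 factorizations of the hard words -/

section Parse

variable {σ : Type}

theorem IsLZ78Factorization.mem_of_prefix {w : List σ} {D : List (List σ)} {p : List σ}
    (hD : IsLZ78Factorization w D p) (n : ℕ) {x q : List σ} (hn : x.length = n) (hx : x ∈ D)
    (hq : q <+: x) : q ∈ [] :: D := by
  induction n using Nat.strong_induction_on generalizing x with
  | _ n ih =>
  obtain ⟨i, hi, rfl⟩ := List.getElem_of_mem hx
  obtain ⟨f, hf, a, hfa⟩ := hD.extends_earlier i hi
  rw [hfa, List.prefix_concat_iff] at hq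
  rcases hq with rfl | hq
  · rw [← hfa]
    exact List.mem_cons_of_mem _ hx
  · rcases List.mem_cons.mp hf with rfl | hf
    · rw [List.prefix_nil] at hq
      simp [hq]
    · refine ih f.length ?_ rfl (List.mem_of_mem_take hf) hq
      rw [← hn, hfa]
      simp

variable [DecidableEq σ]

theorem lz78Factorization_append_singleton (w : List σ) (a : σ) :
    lz78Factorization (w ++ [a]) = lz78Step (lz78Factorization w) a := by
  simp [lz78Factorization]

/-- A word that extends an earlier factor by one letter is read as a single factor. -/
theorem lz78Factorization_append_factor {v : List σ} {D : List (List σ)}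
    (hv : lz78Factorization v = (D, [])) {y : List σ} (hy : y ≠ []) (hpre : y.dropLast ∈ [] :: D)
    (hnew : y ∉ D) : lz78Factorization (v ++ y) = (D ++ [y], []) := by
  have hD := isLZ78Factorization_lz78Factorization v
  rw [hv] at hD
  have hread : ∀ q, q <+: y.dropLast → lz78Factorization (v ++ q) = (D, q) := by
    intro q
    induction q using List.reverseRecOn with
    | nil => intro _; simpa using hv
    | append_singleton q a ih =>
      intro hq
      rw [← List.append_assoc, lz78Factorization_append_singleton,
        ih ((List.prefix_append _ _).trans hq)]
      have hmem : q ++ [a] ∈ D := by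
        rcases List.mem_cons.mp hpre with h | h
        · rw [h] at hq
          simp at hq
        · simpa using hD.mem_of_prefix _ rfl h hq
      simp [lz78Step, hmem]
  rw [← List.dropLast_append_getLast hy, ← List.append_assoc, lz78Factorization_append_singleton,
    hread _ (List.prefix_refl _)]
  have hnew' : y.dropLast ++ [y.getLast hy] ∉ D := by
    rwa [List.dropLast_append_getLast hy]
  simp only [lz78Step, hnew', if_false]

theorem length_lz78Factorization_le_append (v u : List σ) :
    (lz78Factorization v).1.length ≤ (lz78Factorization (v ++ u)).1.length := by
  induction u using List.reverseRecOn with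
  | nil => simp
  | append_singleton u a ih =>
    rw [← List.append_assoc, lz78Factorization_append_singleton]
    refine ih.trans ?_
    unfold lz78Step
    split_ifs <;> simp

theorem exists_lz78Factorization_replicate (a : σ) (L : ℕ) :
    ∃ D, lz78Factorization (List.replicate (∑ i ∈ Finset.range (L + 1), i) a) = (D, []) ∧
      ∀ x, x ∈ D ↔ ∃ i, 1 ≤ i ∧ i ≤ L ∧ x = List.replicate i a := by
  induction L with
  | zero =>
    refine ⟨[], by simp [lz78Factorization], fun x => ?_⟩
    simp only [List.not_mem_nil, false_iff]
    rintro ⟨i, h1, h2, -⟩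
    omega
  | succ L ih =>
    obtain ⟨D, hD, hmem⟩ := ih
    refine ⟨D ++ [List.replicate (L + 1) a], ?_, fun x => ?_⟩
    · rw [Finset.sum_range_succ, List.replicate_add]
      refine lz78Factorization_append_factor hD (by simp) ?_ ?_
      · rw [List.dropLast_replicate, List.mem_cons, hmem]
        rcases Nat.eq_zero_or_pos L with rfl | hL
        · simp
        · exact Or.inr ⟨L, hL, le_rfl, rfl⟩
      · rw [hmem]
        rintro ⟨i, -, hi, h⟩
        have := congrArg List.length h
        simp only [List.length_replicate] at this
        omega
    · rw [List.mem_append, hmem, List.mem_singleton]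
      constructor
      · rintro (⟨i, h1, h2, rfl⟩ | rfl)
        · exact ⟨i, h1, by omega, rfl⟩
        · exact ⟨L + 1, by omega, le_rfl, rfl⟩
      · rintro ⟨i, h1, h2, rfl⟩
        rcases Nat.lt_or_ge L i with h | h
        · right
          rw [show i = L + 1 by omega]
        · exact Or.inl ⟨i, h1, h, rfl⟩

/-- The first `t` blocks of the word `z₀ a^L z₁ a^L ⋯` with periodic separators. -/
def blocks {m : ℕ} (a : σ) (z : ZMod m → List σ) (L t : ℕ) : List σ :=
  (List.range t).flatMap fun τ : ℕ => z (τ : ZMod m) ++ List.replicate L a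

omit [DecidableEq σ] in
theorem blocks_succ {m : ℕ} (a : σ) (z : ZMod m → List σ) (L t : ℕ) :
    blocks a z L (t + 1) = blocks a z L t ++ (z t ++ List.replicate L a) := by
  simp [blocks, List.range_succ]

omit [DecidableEq σ] in
theorem blocks_mul {m : ℕ} (a : σ) (z : ZMod m → List σ) (L r : ℕ) :
    blocks a z L (m * r) = (List.replicate r (blocks a z L m)).flatten := by
  induction r with
  | zero => simp [blocks]
  | succ r ih =>
    rw [List.replicate_succ', List.flatten_concat, ← ih, mul_add, mul_one, blocks, List.range_add,
      List.flatMap_append, List.flatMap_map]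
    simp [blocks]

/-- Parsing `z₀ a^L z₁ a^L ⋯` is a rotor walk: when `i` letters `a` are left before the separator
`zⱼ`, the next factor is `aⁱ zⱼ aᶜ` with the least `c` that has not been used for `j` and `i`, and it
leaves `L - c` letters `a` before the next separator. -/
theorem exists_rotorState_blocks {m L : ℕ} [NeZero m] {a : σ} {v₀ : List σ} {D₀ : List (List σ)}
    (h₀ : lz78Factorization v₀ = (D₀, [])) (z : ZMod m → List σ) (hz : ∀ j, z j ≠ [])
    (hnew : ∀ j i c, List.replicate i a ++ z j ++ List.replicate c a ∉ D₀)
    (hinj : ∀ j i c j' i' c', List.replicate i a ++ z j ++ List.replicate c a =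
      List.replicate i' a ++ z j' ++ List.replicate c' a → j = j' ∧ i = i' ∧ c = c')
    (hpre : ∀ j, ∀ i ≤ L, (List.replicate i a ++ z j).dropLast ∈ [] :: D₀)
    (t : ℕ) (ht : t ≤ m * (L + 1) ^ 2) :
    ∃ (cnt : ZMod m × Fin (L + 1) → ℕ) (cur : ZMod m × Fin (L + 1)) (u : List σ)
      (D : List (List σ)), IsRotorState cnt cur t ∧ lz78Factorization (v₀ ++ u) = (D, []) ∧
      D.length = D₀.length + t ∧
      (∀ x, x ∈ D ↔ x ∈ D₀ ∨ ∃ v c, c < cnt v ∧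
        x = List.replicate v.2 a ++ z v.1 ++ List.replicate c a) ∧
      u ++ List.replicate cur.2 a = blocks a z L t := by
  induction t with
  | zero =>
    exact ⟨fun _ => 0, 0, [], D₀, IsRotorState.init, by simpa using h₀, rfl, by simp,
      by simp [blocks]⟩
  | succ t ih =>
    obtain ⟨cnt, cur, u, D, hst, hfac, hlen, hmem, hu⟩ := ih (by omega)
    have hlt := hst.lt_of_lt (by omega : t < m * (L + 1) ^ 2)
    set y := List.replicate cur.2 a ++ z cur.1 ++ List.replicate (cnt cur) a with hy
    refine ⟨_, _, u ++ y, D ++ [y], hst.step hlt, ?_, ?_, ?_, ?_⟩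
    · rw [← List.append_assoc]
      refine lz78Factorization_append_factor hfac ?_ ?_ ?_
      · simp [hy, hz]
      · rcases Nat.eq_zero_or_pos (cnt cur) with hc | hc
        · have := hpre cur.1 cur.2 (Nat.lt_succ_iff.mp cur.2.2)
          rw [List.mem_cons] at this ⊢
          rw [hmem]
          simp only [hy, hc, List.replicate_zero, List.append_nil]
          tauto
        · obtain ⟨c, hc⟩ := Nat.exists_eq_succ_of_ne_zero hc.ne'
          rw [hy, hc, Nat.succ_eq_add_one, List.replicate_succ', ← List.append_assoc,
            List.dropLast_concat, List.mem_cons, hmem]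
          exact Or.inr (Or.inr ⟨cur, c, by omega, rfl⟩)
      · rw [hmem]
        rintro (h | ⟨v, c, hc, h⟩)
        · exact hnew _ _ _ h
        · obtain ⟨h1, h2, h3⟩ := hinj _ _ _ _ _ _ h
          have : cur = v := Prod.ext h1 (Fin.ext h2)
          subst this
          omega
    · simp only [List.length_append, List.length_singleton, hlen]
      omega
    · intro x
      rw [List.mem_append, hmem, List.mem_singleton, or_assoc]
      refine or_congr_right ⟨?_, ?_⟩
      · rintro (⟨v, c, hc, rfl⟩ | rfl)
        · refine ⟨v, c, hc.trans_le ?_, rfl⟩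
          by_cases hv : v = cur
          · subst hv; simp
          · simp [hv]
        · exact ⟨cur, cnt cur, by simp, rfl⟩
      · rintro ⟨v, c, hc, rfl⟩
        by_cases hv : v = cur
        · subst hv
          rw [Function.update_self] at hc
          rcases Nat.lt_succ_iff_lt_or_eq.mp hc with hc | rfl
          · exact Or.inl ⟨_, c, hc, rfl⟩
          · exact Or.inr rfl
        · rw [Function.update_of_ne hv] at hc
          exact Or.inl ⟨v, c, hc, rfl⟩
    · have e : cnt cur + (L + 1 - (cnt cur + 1)) = L := by omega
      rw [blocks_succ, ← hu, ← hst.phase, hy]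
      simp only [Fin.val_rev, List.append_assoc, List.replicate_append_replicate, e]

theorem exists_lz78Factorization_blocks {m L : ℕ} [NeZero m] {a : σ} {v₀ : List σ}
    {D₀ : List (List σ)} (h₀ : lz78Factorization v₀ = (D₀, [])) (z : ZMod m → List σ)
    (hz : ∀ j, z j ≠ [])
    (hnew : ∀ j i c, List.replicate i a ++ z j ++ List.replicate c a ∉ D₀)
    (hinj : ∀ j i c j' i' c', List.replicate i a ++ z j ++ List.replicate c a =
      List.replicate i' a ++ z j' ++ List.replicate c' a → j = j' ∧ i = i' ∧ c = c')
    (hpre : ∀ j, ∀ i ≤ L, (List.replicate i a ++ z j).dropLast ∈ [] :: D₀) :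
    ∃ D, lz78Factorization (v₀ ++ blocks a z L (m * (L + 1) ^ 2)) = (D, []) ∧
      D.length = D₀.length + m * (L + 1) ^ 2 ∧
      ∀ x, x ∈ D ↔ x ∈ D₀ ∨ ∃ j i c, i ≤ L ∧ c ≤ L ∧
        x = List.replicate i a ++ z j ++ List.replicate c a := by
  obtain ⟨cnt, cur, u, D, hst, hfac, hlen, hmem, hu⟩ :=
    exists_rotorState_blocks h₀ z hz hnew hinj hpre _ le_rfl
  rw [hst.cur_of_complete] at hu
  simp only [Prod.snd_zero, Fin.val_zero, List.replicate_zero, List.append_nil] at hu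
  refine ⟨D, hu ▸ hfac, hlen, fun x => ?_⟩
  rw [hmem]
  refine or_congr_right ⟨?_, ?_⟩
  · rintro ⟨v, c, hc, rfl⟩
    rw [hst.eq_of_complete] at hc
    exact ⟨v.1, v.2, c, Nat.lt_succ_iff.mp v.2.2, Nat.lt_succ_iff.mp hc, rfl⟩
  · rintro ⟨j, i, c, hi, hc, rfl⟩
    refine ⟨(j, ⟨i, Nat.lt_succ_of_le hi⟩), c, ?_, rfl⟩
    rw [hst.eq_of_complete]
    exact Nat.lt_succ_of_le hc

omit [DecidableEq σ] in
theorem replicate_append_cons_inj {a b : σ} (hab : a ≠ b) {i i' : ℕ} {r r' : List σ}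
    (h : List.replicate i a ++ b :: r = List.replicate i' a ++ b :: r') : i = i' ∧ r = r' := by
  induction i generalizing i' with
  | zero => cases i' <;> simp_all [List.replicate_succ, hab.symm]
  | succ i ih =>
    cases i' with
    | zero => simp [List.replicate_succ, hab] at h
    | succ i' =>
      simp only [List.replicate_succ, List.cons_append, List.cons.injEq, true_and] at h
      simpa using ih h

/-- The first power in the hard word provides all factors `aⁱ b aᶜ`. Hence every `aⁱ b aʲ⁺¹` with
`j < m ≤ L` is available, so that in the second power no factor ends inside a separator. -/
theorem le_length_lz78Factorization_hardWord {a b : σ} (hab : a ≠ b) {L m : ℕ} (hm : m ≠ 0)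
    (hmL : m ≤ L) : m * (L + 1) ^ 2 ≤ (lz78Factorization (hardWord a b L m)).1.length := by
  have : NeZero m := ⟨hm⟩
  obtain ⟨D₀, h₀, hmem₀⟩ := exists_lz78Factorization_replicate a L
  have hcount : ∀ i, List.count b (List.replicate i a) = 0 := fun i =>
    List.count_eq_zero_of_not_mem fun h => hab (List.eq_of_mem_replicate h).symm
  obtain ⟨D₁, h₁, -, hmem₁⟩ := exists_lz78Factorization_blocks (m := 1) (L := L) (a := a) h₀
    (fun _ => [b]) (by simp) (by
      intro j i c h
      obtain ⟨i', -, -, h⟩ := (hmem₀ _).mp h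
      have := congrArg (List.count b) h
      simp [hcount] at this) (by
      intro j i c j' i' c' h
      simp only [List.append_assoc, List.singleton_append] at h
      obtain ⟨h1, h2⟩ := replicate_append_cons_inj hab h
      have := congrArg List.length h2
      simp only [List.length_replicate] at this
      exact ⟨Subsingleton.elim _ _, h1, this⟩) (by
      intro j i hi
      rw [List.dropLast_concat, List.mem_cons, hmem₀]
      rcases Nat.eq_zero_or_pos i with rfl | h
      · simp
      · exact Or.inr ⟨i, h, hi, rfl⟩)
  obtain ⟨D₂, h₂, hlen₂, -⟩ := exists_lz78Factorization_blocks (m := m) (L := L) (a := a) h₁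
    (fun j => separator a b j.val) (by simp [separator]) (by
      intro j i c h
      rcases (hmem₁ _).mp h with h | ⟨-, i', c', -, -, h⟩
      · obtain ⟨i', -, -, h⟩ := (hmem₀ _).mp h
        have := congrArg (List.count b) h
        simp [separator, hcount] at this
      · have := congrArg (List.count b) h
        simp [separator, hcount] at this) (by
      intro j i c j' i' c' h
      simp only [separator, List.append_assoc, List.cons_append, List.nil_append] at h
      obtain ⟨h1, h2⟩ := replicate_append_cons_inj hab h
      obtain ⟨h3, h4⟩ := replicate_append_cons_inj hab h2
      have := congrArg List.length h4
      simp only [List.length_replicate] at this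
      exact ⟨ZMod.val_injective m (by omega), h1, this⟩) (by
      intro j i hi
      rw [List.mem_cons, hmem₁]
      right; right
      refine ⟨0, i, j.val + 1, hi, (ZMod.val_lt j).trans_le hmL, ?_⟩
      have : List.replicate i a ++ separator a b j.val =
          (List.replicate i a ++ [b] ++ List.replicate (j.val + 1) a) ++ [b] := by
        simp [separator]
      rw [this, List.dropLast_concat])
  have e₁ : blocks a (fun _ : ZMod 1 => [b]) L (1 * (L + 1) ^ 2) =
      (List.replicate ((L + 1) ^ 2) (b :: List.replicate L a)).flatten := by
    rw [blocks_mul]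
    simp [blocks]
  have e₂ : blocks a (fun j : ZMod m => separator a b j.val) L (m * (L + 1) ^ 2) =
      (List.replicate ((L + 1) ^ 2) (separatedRuns a b L m)).flatten := by
    rw [blocks_mul]
    congr 2
    unfold blocks separatedRuns
    refine List.flatMap_congr fun τ hτ => ?_
    beta_reduce
    rw [ZMod.val_natCast, Nat.mod_eq_of_lt (List.mem_range.mp hτ)]
  rw [e₁, e₂, List.append_assoc] at h₂
  rw [hardWord, h₂]
  exact hlen₂ ▸ Nat.le_add_left _ _

end Parse

/-! ### The lower bound -/

section LowerBound

theorem length_hardWord_le {σ : Type} (a b : σ) {L m : ℕ} (hm : m ≠ 0) (hmL : m ≤ L) :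
    (hardWord a b L m).length ≤ 4 * m * (L + 1) ^ 3 := by
  have hruns : ∀ t, t ≤ m → (separatedRuns a b L t).length ≤ t * (2 * (L + 1)) := by
    intro t
    induction t with
    | zero => simp [separatedRuns]
    | succ t ih =>
      intro ht
      have := ih (by omega)
      rw [separatedRuns_succ]
      simp only [separator, List.length_append, List.length_cons, List.length_replicate,
        List.length_nil, add_mul, one_mul]
      omega
  have hsum : ∑ i ∈ Finset.range (L + 1), i ≤ (L + 1) ^ 2 := by
    refine (Finset.sum_le_card_nsmul _ _ (L + 1) fun i hi => ?_).trans (by simp [sq])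
    exact (Finset.mem_range.mp hi).le
  have hlen : (hardWord a b L m).length = (∑ i ∈ Finset.range (L + 1), i) +
      ((L + 1) ^ 2 * (L + 1) + (L + 1) ^ 2 * (separatedRuns a b L m).length) := by
    simp [hardWord]
  rw [hlen]
  have h1 := Nat.mul_le_mul_left ((L + 1) ^ 2) (hruns m le_rfl)
  have h2 : (L + 1) ^ 2 * 1 ≤ (L + 1) ^ 2 * (L + 1) := Nat.mul_le_mul_left _ (by omega)
  have h3 : 1 * (L + 1) ^ 3 ≤ m * (L + 1) ^ 3 := Nat.mul_le_mul_right _ (by omega)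
  nlinarith

variable {σ : Type} [DecidableEq σ]

/-- With `m` about `log n`, the hard word has a grammar of size `O(m)` and at least `m (L + 1)²`
factors; padding by letters `a` only changes this by a constant factor. -/
theorem exists_le_lz78_ratio {a b : σ} (hab : a ≠ b) {L n : ℕ} (hm : Nat.log 2 n ≠ 0)
    (hmL : Nat.log 2 n ≤ L) (hn : 4 * Nat.log 2 n * (L + 1) ^ 3 ≤ n) :
    ∃ (w : List σ) (hw : w ≠ []), w.length = n ∧
      ((L + 1 : ℕ) : ℝ) ^ 2 / 40 ≤ (lz78Compressor σ).ratio w hw := by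
  set m := Nat.log 2 n with hmdef
  have hle := (length_hardWord_le a b hm hmL).trans hn
  set w := hardWord a b L m ++ List.replicate (n - (hardWord a b L m).length) a with hwdef
  have hwn : w.length = n := by
    simp only [hwdef, List.length_append, List.length_replicate]
    omega
  have hn2 : 2 ≤ n := by
    by_contra h
    exact hm (Nat.log_of_lt (by omega))
  have hw : w ≠ [] := List.ne_nil_of_length_pos (by omega)
  refine ⟨w, hw, hwn, ?_⟩
  obtain ⟨l, hl, hwl, hlen⟩ := exists_wordChain_hardWord a b (L := L) (m := m) (by omega) hm
    (n - (hardWord a b L m).length)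
  rw [← hwdef] at hwl hlen
  rw [hwn, ← hmdef] at hlen
  have hg : smallestSLPSize w ≤ 40 * m := (hl.smallestSLPSize_le hwl).trans (by omega)
  have hsize : m * (L + 1) ^ 2 ≤ ((lz78Compressor σ).compress w hw).size :=
    (le_length_lz78Factorization_hardWord hab hm hmL).trans
      ((length_lz78Factorization_le_append _ _).trans (length_le_size_lz78SLP hw _ _
        (isLZ78Factorization_lz78Factorization w)))
  have hlog : 0 < Real.log w.length := Real.log_pos (by rw [hwn]; exact_mod_cast hn2)
  have hg0 : (0 : ℝ) < smallestSLPSize w := hlog.trans_le (log_length_le_smallestSLPSize hw)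
  unfold GrammarCompressor.ratio
  rw [le_div_iff₀ hg0]
  have h1 : (smallestSLPSize w : ℝ) ≤ 40 * m := by exact_mod_cast hg
  have h2 : (m : ℝ) * ((L + 1 : ℕ) : ℝ) ^ 2 ≤ ((lz78Compressor σ).compress w hw).size := by
    exact_mod_cast hsize
  refine le_trans ?_ h2
  calc ((L + 1 : ℕ) : ℝ) ^ 2 / 40 * smallestSLPSize w
      ≤ ((L + 1 : ℕ) : ℝ) ^ 2 / 40 * (40 * m) := by gcongr
    _ = _ := by ring

theorem four_mul_mul_le_two_pow {m : ℕ} (hm : 20 ≤ m) : 4 * m * (m + 1) ^ 3 ≤ 2 ^ m := by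
  induction m, hm using Nat.le_induction with
  | base => norm_num
  | succ m hm ih =>
    have h : (m + 1 + 1) ^ 3 ≤ 2 * m * (m + 1) ^ 2 := by
      obtain ⟨k, rfl⟩ := Nat.exists_eq_add_of_le hm
      nlinarith [Nat.zero_le (k ^ 3), Nat.zero_le (k ^ 2)]
    calc 4 * (m + 1) * (m + 1 + 1) ^ 3 ≤ 4 * (m + 1) * (2 * m * (m + 1) ^ 2) :=
          Nat.mul_le_mul_left _ h
      _ = 4 * m * (m + 1) ^ 3 * 2 := by ring
      _ ≤ 2 ^ m * 2 := Nat.mul_le_mul_right _ ih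
      _ = 2 ^ (m + 1) := (pow_succ _ _).symm

/-- The largest possible run length `L + 1` for words of length `n` is about
`(n / log n) ^ (1 / 3)`. -/
theorem exists_run_length {n : ℕ} (hn : 2 ^ 20 ≤ n) :
    ∃ L : ℕ, Nat.log 2 n ≤ L ∧ 4 * Nat.log 2 n * (L + 1) ^ 3 ≤ n ∧
      n < 32 * Nat.log 2 n * (L + 1) ^ 3 := by
  set m := Nat.log 2 n with hmdef
  have hm : 20 ≤ m := Nat.le_log_of_pow_le (by norm_num) hn
  have hm0 : 4 * m * (m + 1) ^ 3 ≤ n :=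
    (four_mul_mul_le_two_pow hm).trans (Nat.pow_log_le_self 2 (by omega))
  let P : ℕ → Prop := fun K => 4 * m * K ^ 3 ≤ n
  have hbound : ∀ K, P K → K ≤ n := by
    intro K hK
    refine le_trans ?_ hK
    calc K ≤ K ^ 3 := Nat.le_self_pow (by norm_num) K
      _ ≤ 4 * m * K ^ 3 := Nat.le_mul_of_pos_left _ (by omega)
  have hmP : P (m + 1) := hm0
  set K := Nat.findGreatest P n with hK
  have hPK : P K := Nat.findGreatest_spec (hbound _ hmP) hmP
  have hmK : m + 1 ≤ K := Nat.le_findGreatest (hbound _ hmP) hmP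
  have hnot : ¬ P (K + 1) := fun h => by
    have := Nat.le_findGreatest (hbound _ h) h
    omega
  refine ⟨K - 1, by omega, ?_, ?_⟩
  · rw [Nat.sub_add_cancel (by omega)]
    exact hPK
  · rw [Nat.sub_add_cancel (by omega)]
    have h2 : (K + 1) ^ 3 ≤ (2 * K) ^ 3 := Nat.pow_le_pow_left (by omega) 3
    have h3 := Nat.mul_le_mul_left (4 * m) h2
    have h4 : n < 4 * m * (K + 1) ^ 3 := not_le.mp hnot
    calc n < 4 * m * (2 * K) ^ 3 := h4.trans_le h3
      _ = 32 * m * K ^ 3 := by ring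

/-- For `n < 2 ^ 20` the bound is at most `1`, and the ratio is never below `1`; this case determines
the constant. -/
theorem exists_div_log_le_lz78_ratio {a b : σ} (hab : a ≠ b) {n : ℕ} (hn : 2 ≤ n) :
    ∃ (w : List σ) (hw : w ≠ []), w.length = n ∧
      1 / 2 ^ 21 * ((n : ℝ) / Real.log n) ^ (2 / 3 : ℝ) ≤ (lz78Compressor σ).ratio w hw := by
  have hn1 : (1 : ℝ) < n := by exact_mod_cast hn
  have hn0 : (0 : ℝ) < n := by linarith
  have hlog : 0 < Real.log n := Real.log_pos hn1
  by_cases hbig : 2 ^ 20 ≤ n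
  · obtain ⟨L, hmL, hle, hlt⟩ := exists_run_length hbig
    have hm : Nat.log 2 n ≠ 0 := (Nat.log_pos (by norm_num) hn).ne'
    obtain ⟨w, hw, hwn, hr⟩ := exists_le_lz78_ratio hab hm hmL hle
    refine ⟨w, hw, hwn, le_trans ?_ hr⟩
    set K : ℝ := ((L + 1 : ℕ) : ℝ) with hK
    have hK0 : 0 ≤ K := by positivity
    have hlogm : (Nat.log 2 n : ℝ) ≤ 2 * Real.log n := by
      have h1 : (2 : ℝ) ^ Nat.log 2 n ≤ n := by
        exact_mod_cast Nat.pow_log_le_self 2 (by omega : n ≠ 0)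
      have h2 := Real.log_le_log (by positivity) h1
      rw [Real.log_pow] at h2
      nlinarith [Real.log_two_gt_d9, (Nat.cast_nonneg (Nat.log 2 n) : (0 : ℝ) ≤ _)]
    have hlt' : (n : ℝ) ≤ 32 * Nat.log 2 n * K ^ 3 := by
      rw [hK]
      exact_mod_cast hlt.le
    have hx : (n : ℝ) / Real.log n ≤ (4 * K) ^ 3 := by
      rw [div_le_iff₀ hlog]
      have := mul_le_mul_of_nonneg_right hlogm (pow_nonneg hK0 3)
      nlinarith
    have hx' : ((n : ℝ) / Real.log n) ^ (2 / 3 : ℝ) ≤ (4 * K) ^ 2 := by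
      calc ((n : ℝ) / Real.log n) ^ (2 / 3 : ℝ) ≤ ((4 * K) ^ 3) ^ (2 / 3 : ℝ) := by gcongr
        _ = (4 * K) ^ 2 := by
          rw [← Real.rpow_natCast, ← Real.rpow_mul (by positivity)]
          norm_num
    nlinarith [sq_nonneg K]
  · refine ⟨List.replicate n a, by simp; omega, by simp, le_trans ?_
      (one_le_lz78_ratio _ (by simpa using hn))⟩
    have hx1 : 1 ≤ (n : ℝ) / Real.log n := by
      rw [one_le_div hlog]
      exact Real.log_le_self hn0.le
    have hx : (n : ℝ) / Real.log n ≤ 2 ^ 21 := by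
      rw [div_le_iff₀ hlog]
      have h1 : Real.log 2 ≤ Real.log n :=
        Real.log_le_log (by norm_num) (by exact_mod_cast hn)
      have h2 : (n : ℝ) ≤ 2 ^ 20 := by exact_mod_cast (not_le.mp hbig).le
      nlinarith [Real.log_two_gt_d9]
    have hx' : ((n : ℝ) / Real.log n) ^ (2 / 3 : ℝ) ≤ (n : ℝ) / Real.log n := by
      calc _ ≤ ((n : ℝ) / Real.log n) ^ (1 : ℝ) :=
            Real.rpow_le_rpow_of_exponent_le hx1 (by norm_num)
        _ = _ := Real.rpow_one _
    linarith

end LowerBound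

theorem theorem3 :
    ∃ c C : ℝ, 0 < c ∧ 0 < C ∧ ∀ k n : ℕ, 2 ≤ k → k ≤ n →
      c * ((n : ℝ) / Real.log n) ^ (2 / 3 : ℝ) ≤ lz78WorstCaseRatio k n ∧
      lz78WorstCaseRatio k n ≤ C * ((n : ℝ) / Real.log n) ^ (2 / 3 : ℝ) := by
  refine ⟨1 / 2 ^ 21, 20, by norm_num, by norm_num, fun k n hk hkn => ?_⟩
  have : Nonempty (Fin k) := ⟨⟨0, by omega⟩⟩
  have hmax := (lz78Compressor (Fin k)).isGreatest_worstCaseRatio (n := n) (by omega)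
  unfold lz78WorstCaseRatio
  constructor
  · have hab : (⟨0, by omega⟩ : Fin k) ≠ ⟨1, by omega⟩ := by simp
    obtain ⟨w, hw, hwn, hr⟩ := exists_div_log_le_lz78_ratio hab (hk.trans hkn)
    exact hr.trans (hmax.2 ⟨w, hw, hwn, rfl⟩)
  · obtain ⟨w, hw, hwn, hr⟩ := hmax.1
    rw [← hr, ← hwn]
    exact lz78_ratio_le hw (by omega)
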